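/- Let $F$ be a 2-field, i.e. a field with no nontrivial finite extension of odd degree, and let $A$ be a central division algebra over $F$ of degree $2^n$ (so $\dim_F A = 2^{2n}$) and exponent $2$ (i.e. its class in the Brauer group of $F$ has order $2$), where $n \geq 2$. Call a noncentral element $v \in A$ square-central if $v^2 \in F^\times$, and, when $\operatorname{char}(F)=2$, call a noncentral element $v \in A$ Artin-Schreier if $v^2+v \in F$. If $\operatorname{char}(F)=2$, then for any two Artin-Schreier elements in $A$ there exists an element of $A$, either Artin-Schreier or square-central, commuting with them both. If $\operatorname{char}(F) \neq 2$, then for any two square-central elements in $A$ there exists a square-central element of $A$ commuting with them both. -/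

import Mathlib

open scoped TensorProduct

universe u v

/-- `F` is a 2-field (also called 2-special): it has no nontrivial finite field extension of odd
degree. -/
def IsTwoField (F : Type u) [Field F] : Prop :=
  ∀ (K : Type u) [Field K] [Algebra F K] [FiniteDimensional F K],
    Odd (Module.finrank F K) → Module.finrank F K = 1

/-- The `F`-algebra `B` is split: it is a full matrix algebra over `F`, that is, a central simple
algebra with trivial Brauer class. -/
def IsSplitAlgebra (F : Type u) (B : Type v) [Field F] [Ring B] [Algebra F B] : Prop :=
  ∃ m : ℕ, m ≠ 0 ∧ Nonempty (B ≃ₐ[F] Matrix (Fin m) (Fin m) F)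

/-- The central simple `F`-algebra `A` has exponent 2: its class in the Brauer group of `F` has
order exactly 2, that is, `A` is not split but `A ⊗ A` is. -/
def HasExponentTwo (F : Type u) (A : Type v) [Field F] [Ring A] [Algebra F A] : Prop :=
  ¬ IsSplitAlgebra F A ∧ IsSplitAlgebra F (A ⊗[F] A)

/-- A noncentral element whose square is a nonzero scalar. -/
def IsSquareCentral (F : Type u) {A : Type v} [Field F] [Ring A] [Algebra F A] (x : A) : Prop :=
  x ∉ Subalgebra.center F A ∧ ∃ a : F, a ≠ 0 ∧ x ^ 2 = algebraMap F A a

/-- A noncentral element `x` for which `x ^ 2 + x` is a scalar (used in characteristic 2). -/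
def IsArtinSchreier (F : Type u) {A : Type v} [Field F] [Ring A] [Algebra F A] (x : A) : Prop :=
  x ∉ Subalgebra.center F A ∧ ∃ a : F, x ^ 2 + x = algebraMap F A a

/-!
Square-central elements in characteristic different from 2, and Artin-Schreier elements in
characteristic 2, are quadratic and separable over `F`. Let `x` and `t` be two such elements, roots
of `X² - p X - q` and `X² - r X - s`. The argument has two independent halves.

The first produces some `w` outside `F` commuting with `x` and `t`; it is
`exists_notMem_bot_commute`, and it does not involve 2-fields. If `x` and `t` commute, take `w = x`.
Otherwise two elements built from the pair always commute with both: the polar form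
`x t + t x - r x - p t` of the reduced norm, and the square of the commutator `g = x t - t x`. If
one of them is not in `F`, it serves as `w`. If both are in `F`, then `x` and `g` generate a
quaternion algebra containing `t`; by `finrank_le_four_mul_finrank_centralizer` its centralizer has
dimension at least `dim A / 4 ≥ 4`, hence is larger than `F`.

The second half finds a quadratic element in the field `F(w)`
(`IsTwoField.exists_isQuadraticElem_mem_adjoin`). The degree of this field over `F` divides `dim A`,
so it is a power of 2. If `F(w)` is not purely inseparable over `F`, its maximal separable
subextension is nontrivial; the Galois group of the normal closure of the latter is a 2-group
because `F` is a 2-field, and a proper subgroup of a 2-group is contained in one of index 2, whose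
fixed field is quadratic. If it is purely inseparable, the characteristic is 2 and some iterated
square of `w` is quadratic.

A quadratic element `z` commuting with `x` and `t` becomes square-central or Artin-Schreier by
completing the square or, in characteristic 2, dividing by the trace when that is not zero.
-/

/-! ### Quadratic elements in extensions of 2-fields -/

/-- A quadratic element: a root of a monic polynomial of degree 2 over `F` which does not lie in
`F`. -/
def IsQuadraticElem (F : Type u) {A : Type v} [Field F] [Ring A] [Algebra F A] (z : A) : Prop :=
  z ∉ (⊥ : Subalgebra F A) ∧ ∃ p q : F, z ^ 2 = p • z + algebraMap F A q

open IntermediateField in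
/-- Over a 2-field, every finite Galois group is a 2-group: the fixed field of a Sylow 2-subgroup
has odd degree. -/
theorem IsTwoField.isPGroup_gal {F N : Type u} [Field F] [Field N] [Algebra F N]
    [FiniteDimensional F N] [IsGalois F N] (hF : IsTwoField F) : IsPGroup 2 Gal(N/F) := by
  obtain ⟨P⟩ : Nonempty (Sylow 2 Gal(N/F)) := inferInstance
  have hindex : Module.finrank F (fixedField (P : Subgroup Gal(N/F))) =
      (P : Subgroup Gal(N/F)).index := by
    rw [finrank_eq_fixingSubgroup_index, fixingSubgroup_fixedField]
  have hodd : Odd (Module.finrank F (fixedField (P : Subgroup Gal(N/F)))) := by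
    rw [hindex, ← Nat.not_even_iff_odd, even_iff_two_dvd]
    exact P.not_dvd_index
  have htop : (P : Subgroup Gal(N/F)) = ⊤ :=
    Subgroup.index_eq_one.mp (hindex ▸ hF _ hodd)
  have hP := P.isPGroup'
  rw [htop] at hP
  exact hP.of_equiv Subgroup.topEquiv

open IntermediateField in
/-- In the Galois group of the normal closure of `E`, which is a 2-group, the proper subgroup
fixing `E` is contained in a subgroup of index 2. -/
theorem IsTwoField.exists_finrank_eq_two_of_isSeparable {F E : Type u} [Field F] [Field E]
    [Algebra F E] [FiniteDimensional F E] [Algebra.IsSeparable F E] (hF : IsTwoField F)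
    (hE : Module.finrank F E ≠ 1) :
    ∃ K : IntermediateField F E, Module.finrank F K = 2 := by
  let N := normalClosure F E (AlgebraicClosure E)
  have hsep : Algebra.IsSeparable F N := by
    have (f : E →ₐ[F] AlgebraicClosure E) : Algebra.IsSeparable F f.fieldRange :=
      AlgEquiv.Algebra.isSeparable (AlgEquiv.ofInjectiveField f)
    exact isSeparable_iSup F _
  have : IsGalois F N := ⟨⟩
  have hG : IsPGroup 2 Gal(N/F) := hF.isPGroup_gal
  let φ : E →ₐ[F] N := IsScalarTower.toAlgHom F E N
  obtain ⟨m, hm⟩ := IsPGroup.iff_card.mp hG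
  obtain ⟨k, hk⟩ := IsPGroup.iff_card.mp (hG.to_subgroup φ.fieldRange.fixingSubgroup)
  have hφ : Module.finrank F φ.fieldRange ≠ 1 := by
    have h := (AlgEquiv.ofInjectiveField φ).toLinearEquiv.finrank_eq
    exact fun h1 ↦ hE (h.trans h1)
  have hcard := φ.fieldRange.fixingSubgroup.card_mul_index
  rw [hk, hm, ← finrank_eq_fixingSubgroup_index] at hcard
  have hkm : k < m := by
    refine lt_of_le_of_ne ?_ fun h ↦ hφ ?_
    · exact (Nat.pow_dvd_pow_iff_le_right (le_refl 2)).mp ⟨_, hcard.symm⟩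
    · subst h
      exact Nat.eq_of_mul_eq_mul_left (by positivity) (hcard.trans (mul_one _).symm)
  obtain ⟨H, hH, hle⟩ := Sylow.exists_subgroup_card_pow_prime_le 2 (n := k) (m := m - 1)
    (hm ▸ pow_dvd_pow 2 (Nat.sub_le m 1)) φ.fieldRange.fixingSubgroup hk (by omega)
  have hHi : Module.finrank F (fixedField H) = 2 := by
    rw [finrank_eq_fixingSubgroup_index, fixingSubgroup_fixedField]
    have h := H.card_mul_index
    rw [hH, hm, ← Nat.sub_add_cancel (by omega : 1 ≤ m), pow_succ, Nat.add_sub_cancel] at h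
    exact Nat.eq_of_mul_eq_mul_left (by positivity) h
  have hsub : fixedField H ≤ φ.fieldRange := by
    have h := fixedField_le hle
    rwa [IsGalois.fixedField_fixingSubgroup] at h
  refine ⟨(fixedField H).comap φ, ?_⟩
  have hmap : ((fixedField H).comap φ).map φ = fixedField H := by
    ext y
    simp only [mem_map]
    constructor
    · rintro ⟨x, hx, rfl⟩
      exact hx
    · intro hy
      obtain ⟨x, rfl⟩ := hsub hy
      exact ⟨x, hy, rfl⟩
  have h := (((fixedField H).comap φ).equivMap φ).toLinearEquiv.finrank_eq
  rwa [hmap, hHi] at h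

theorem exists_isQuadraticElem_of_finrank_eq_two {F : Type u} {E : Type v} [Field F] [Field E]
    [Algebra F E] (K : IntermediateField F E) (hK : Module.finrank F K = 2) :
    ∃ z : E, IsQuadraticElem F z := by
  have : FiniteDimensional F K := Module.finite_of_finrank_pos (by omega)
  obtain ⟨z, hz, hzb⟩ : ∃ z ∈ K, z ∉ (⊥ : IntermediateField F E) := by
    by_contra! h
    have hbot : K = ⊥ := le_bot_iff.mp fun z hz ↦ h z hz
    rw [hbot, IntermediateField.finrank_bot] at hK
    omega
  refine ⟨z, fun h ↦ hzb (IntermediateField.mem_bot.mpr (Algebra.mem_bot.mp h)), ?_⟩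
  -- `1, z, z²` are linearly dependent in the plane `K`, and the coefficient of `z²` is nonzero.
  have hdep : ¬ LinearIndependent F fun i : Fin 3 ↦ (⟨z, hz⟩ : K) ^ (i : ℕ) := fun h ↦ by
    have := h.fintype_card_le_finrank
    simp [hK] at this
  rw [Fintype.not_linearIndependent_iff] at hdep
  obtain ⟨g, hg, hne⟩ := hdep
  have hg' : algebraMap F E (g 0) + g 1 • z + g 2 • z ^ 2 = 0 := by
    have h := congrArg (algebraMap K E) hg
    simpa [Fin.sum_univ_three, Algebra.smul_def, ← IsScalarTower.algebraMap_apply] using h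
  have h2 : g 2 ≠ 0 := by
    intro h2
    rw [h2, zero_smul, add_zero] at hg'
    by_cases h1 : g 1 = 0
    · have h0 : g 0 = 0 := by simpa [h1] using hg'
      obtain ⟨i, hi⟩ := hne
      fin_cases i <;> simp_all
    · refine hzb (IntermediateField.mem_bot.mpr ⟨-(g 1)⁻¹ * g 0, ?_⟩)
      have h1' : algebraMap F E (g 1) ≠ 0 := by simpa using h1
      rw [Algebra.smul_def] at hg'
      simp only [map_mul, map_neg, map_inv₀]
      field_simp
      linear_combination -hg'
  refine ⟨-(g 2)⁻¹ * g 1, -(g 2)⁻¹ * g 0, ?_⟩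
  have h2' : algebraMap F E (g 2) ≠ 0 := by simpa using h2
  simp only [Algebra.smul_def] at hg' ⊢
  simp only [map_mul, map_neg, map_inv₀]
  field_simp
  linear_combination hg'

/-- A finite extension of 2-power degree of a 2-field contains a quadratic element. If the
extension is not purely inseparable, apply Galois theory to its maximal separable subextension;
otherwise iterate the Frobenius. -/
theorem IsTwoField.exists_isQuadraticElem_of_field {F L : Type u} [Field F] [Field L] [Algebra F L]
    [FiniteDimensional F L] (hF : IsTwoField F) {k : ℕ} (hL : Module.finrank F L = 2 ^ k)
    (hk : k ≠ 0) : ∃ z : L, IsQuadraticElem F z := by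
  by_cases hE : Module.finrank F (separableClosure F L) = 1
  · have hbot : separableClosure F L = ⊥ := IntermediateField.finrank_eq_one_iff.mp hE
    have hpi : IsPurelyInseparable F L := by
      refine isPurelyInseparable_iff.mpr fun x ↦ ⟨Algebra.IsIntegral.isIntegral x, fun hx ↦ ?_⟩
      have := (mem_separableClosure_iff.mpr hx : x ∈ separableClosure F L)
      rw [hbot] at this
      exact IntermediateField.mem_bot.mp this
    obtain ⟨q, hq⟩ := ExpChar.exists F
    obtain ⟨n, hn⟩ := IsPurelyInseparable.finrank_eq_pow F L q
    have hn0 : n ≠ 0 := by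
      rintro rfl
      rw [hL, pow_zero] at hn
      exact absurd hn (Nat.one_lt_two_pow hk).ne'
    have hq2 : q = 2 := by
      have h2q : 2 ∣ q := Nat.prime_two.dvd_of_dvd_pow (n := n) <| by
        rw [← hn, hL]
        exact dvd_pow_self 2 hk
      rcases hq with _ | hp
      · omega
      · exact ((Nat.prime_dvd_prime_iff_eq Nat.prime_two hp).mp h2q).symm
    subst hq2
    obtain ⟨w, hw⟩ : ∃ w : L, w ∉ (⊥ : Subalgebra F L) := by
      by_contra! h
      have h1 : Module.finrank F L = 1 :=
        Subalgebra.bot_eq_top_iff_finrank_eq_one.mp (top_le_iff.mp fun x _ ↦ h x)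
      rw [hL] at h1
      exact absurd h1 (Nat.one_lt_two_pow hk).ne'
    -- The last power in the sequence `w, w ^ 2, w ^ 4, …` outside `F` squares into `F`.
    have hex : ∃ n, w ^ 2 ^ n ∈ (⊥ : Subalgebra F L) := by
      obtain ⟨n, hn⟩ := IsPurelyInseparable.pow_mem F 2 w
      exact ⟨n, Algebra.mem_bot.mpr hn⟩
    classical
    obtain ⟨j, hj⟩ := Nat.exists_eq_succ_of_ne_zero
      (n := Nat.find hex) (by intro h0; exact hw (by simpa [h0] using Nat.find_spec hex))
    refine ⟨w ^ 2 ^ j, Nat.find_min hex (by omega), 0, ?_⟩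
    have hs := Nat.find_spec hex
    rw [hj, Nat.succ_eq_add_one, pow_succ, pow_mul, Algebra.mem_bot] at hs
    obtain ⟨a, ha⟩ := hs
    exact ⟨a, by rw [zero_smul, zero_add, ha]⟩
  · obtain ⟨K, hK⟩ := hF.exists_finrank_eq_two_of_isSeparable hE
    obtain ⟨z, hz, p, q, h⟩ := exists_isQuadraticElem_of_finrank_eq_two K hK
    refine ⟨z, fun hb ↦ hz ?_, p, q, ?_⟩
    · obtain ⟨a, ha⟩ := Algebra.mem_bot.mp hb
      exact Algebra.mem_bot.mpr ⟨a, Subtype.ext ha⟩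
    · simpa using congrArg (algebraMap (separableClosure F L) L) h

/-- The field `F(w)` generated by an element outside `F` of a division algebra of 2-power dimension
has 2-power degree over `F`, so it contains a quadratic element. -/
theorem IsTwoField.exists_isQuadraticElem_mem_adjoin {F : Type u} [Field F] (hF : IsTwoField F)
    {A : Type v} [DivisionRing A] [Algebra F A] [FiniteDimensional F A] {m : ℕ}
    (hA : Module.finrank F A = 2 ^ m) {w : A} (hw : w ∉ (⊥ : Subalgebra F A)) :
    ∃ z ∈ Algebra.adjoin F {w}, IsQuadraticElem F z := by
  have hint : IsIntegral F w := Algebra.IsIntegral.isIntegral w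
  have : Fact (Irreducible (minpoly F w)) := ⟨minpoly.irreducible hint⟩
  -- `AdjoinRoot` provides a model of `F(w)` in the universe of `F`, to which `hF` applies.
  let L := AdjoinRoot (minpoly F w)
  have hfd : FiniteDimensional F L := (AdjoinRoot.powerBasis (minpoly.ne_zero hint)).finite
  have hker : ∀ f ∈ Ideal.span {minpoly F w}, Polynomial.aeval w f = 0 := fun f hf ↦ by
    obtain ⟨g, rfl⟩ := Ideal.mem_span_singleton.mp hf
    simp
  let φ : L →ₐ[F] A := Ideal.Quotient.liftₐ _ (Polynomial.aeval w) hker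
  have hroot : φ (AdjoinRoot.root (minpoly F w)) = w := Polynomial.aeval_X w
  have hmem (l : L) : φ l ∈ Algebra.adjoin F {w} := by
    obtain ⟨f, rfl⟩ := AdjoinRoot.mk_surjective l
    exact Polynomial.aeval_mem_adjoin_singleton F w
  let _ : Module L A := Module.compHom A φ.toRingHom
  have : IsScalarTower F L A := ⟨fun a l y ↦ by
    change φ (a • l) * y = a • (φ l * y)
    rw [map_smul, smul_mul_assoc]⟩
  have hmul := Module.finrank_mul_finrank F L A
  obtain ⟨k, -, hk⟩ := (Nat.dvd_prime_pow Nat.prime_two).mp (hA ▸ Dvd.intro _ hmul)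
  have hk0 : k ≠ 0 := by
    rintro rfl
    have htop : (⊥ : Subalgebra F L) = ⊤ := Subalgebra.bot_eq_top_iff_finrank_eq_one.mpr hk
    obtain ⟨a, ha⟩ := Algebra.mem_bot.mp
      (htop ▸ Algebra.mem_top : AdjoinRoot.root (minpoly F w) ∈ (⊥ : Subalgebra F L))
    exact hw (Algebra.mem_bot.mpr ⟨a, by rw [← hroot, ← ha, φ.commutes]⟩)
  obtain ⟨z, hz, p, q, hzpq⟩ := hF.exists_isQuadraticElem_of_field hk hk0
  refine ⟨φ z, hmem z, fun h ↦ hz ?_, p, q, ?_⟩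
  · obtain ⟨a, ha⟩ := Algebra.mem_bot.mp h
    exact Algebra.mem_bot.mpr ⟨a, φ.toRingHom.injective ((φ.commutes a).trans ha)⟩
  · rw [← map_pow, hzpq, map_add, map_smul, φ.commutes]

/-! ### Centralizers of pairs of quadratic elements -/

/-- Both the image and the kernel of `φ` on `U` are at most as large as `W`. -/
theorem finrank_le_two_mul_of_map_le {F : Type u} [Field F] {A : Type v} [DivisionRing A]
    [Algebra F A] [FiniteDimensional F A] {U W : Submodule F A} (φ : A →ₗ[F] A) {g : A}
    (hg : g ≠ 0) (hmap : ∀ a ∈ U, φ a ∈ W) (hker : ∀ a ∈ U, φ a = 0 → g * a ∈ W) :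
    Module.finrank F U ≤ 2 * Module.finrank F W := by
  have h := (φ.domRestrict U).finrank_range_add_finrank_ker
  have hr : Module.finrank F (φ.domRestrict U).range ≤ Module.finrank F W := by
    refine Submodule.finrank_mono ?_
    rintro _ ⟨a, rfl⟩
    exact hmap a a.2
  have hk : Module.finrank F (φ.domRestrict U).ker ≤ Module.finrank F W := by
    let ψ : (φ.domRestrict U).ker →ₗ[F] W :=
      ((LinearMap.mulLeft F g).comp (U.subtype.comp (φ.domRestrict U).ker.subtype)).codRestrict W
        fun a ↦ hker _ a.1.2 a.2
    refine LinearMap.finrank_le_finrank_of_injective (f := ψ) fun a b hab ↦ ?_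
    have : g * (a.1 : A) = g * (b.1 : A) := congrArg Subtype.val hab
    exact Subtype.ext (Subtype.ext (mul_left_cancel₀ hg this))
  omega

section Pair

variable {F : Type u} [Field F] {A : Type v} [Ring A] [Algebra F A] {p q : F} {x : A}

/-- Passing the commutator across a quadratic element `x` replaces `x` by its conjugate
`p - x`. -/
theorem mul_commutator_of_sq_eq (hx : x ^ 2 = p • x + algebraMap F A q) (t : A) :
    x * (x * t - t * x) = (x * t - t * x) * (algebraMap F A p - x) := by
  have hp := Algebra.commutes p t
  have hq := Algebra.commutes q t
  have hc := Algebra.commutes p x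
  rw [Algebra.smul_def] at hx
  linear_combination (norm := noncomm_ring) hx * t - t * hx + hq + hc * t + x * hp - t * hc

/-- The element `x t + t x - r x - p t` is, up to sign and a scalar, the polar form of the reduced
norm at quadratic elements `x` and `t` of traces `p` and `r`. -/
theorem commute_polar_of_sq_eq (hx : x ^ 2 = p • x + algebraMap F A q) (r : F) (t : A) :
    Commute (x * t + t * x - r • x - p • t) x := by
  have hp := Algebra.commutes p t
  have hq := Algebra.commutes q t
  have hc := Algebra.commutes p x
  have hr := Algebra.commutes r x
  rw [Algebra.smul_def] at hx
  rw [Algebra.smul_def, Algebra.smul_def, Commute, SemiconjBy]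
  linear_combination (norm := noncomm_ring) t * hx - hx * t - hr * x - hp * x - hc * t - hq

theorem commute_sq_of_mul_eq_mul_sub {g : A} (h : x * g = g * (algebraMap F A p - x)) :
    Commute (g ^ 2) x := by
  have hp := Algebra.commutes p g
  rw [Commute, SemiconjBy]
  linear_combination (norm := noncomm_ring) g * h - h * g - g * hp

end Pair

/-- The dimension of the centralizer of a quaternion subalgebra, generated here by `x` and `g`.
With `x̄ = p - x`, the map `a ↦ x a - a x̄` sends `A` into the centralizer `C` of `x`, and left
multiplication by `g` sends its kernel into `C`; so `C` takes up at least half of `A`. Next,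
`a ↦ g a g + g² a` sends `C` into the centralizer of both elements, and left multiplication by
`2 x - p`, which anticommutes with `g`, sends its kernel there as well. -/
theorem finrank_le_four_mul_finrank_centralizer {F : Type u} [Field F] {A : Type v}
    [DivisionRing A] [Algebra F A] [FiniteDimensional F A] {p q d : F} {x g : A}
    (hx : x ^ 2 = p • x + algebraMap F A q) (hsep : 2 * x ≠ algebraMap F A p) (hg : g ≠ 0)
    (hxg : x * g = g * (algebraMap F A p - x)) (hd : algebraMap F A d = g ^ 2) :
    Module.finrank F A ≤ 4 * Module.finrank F (Subalgebra.centralizer F {x, g}) := by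
  let U : Submodule F A := Subalgebra.toSubmodule (Subalgebra.centralizer F {x})
  let W : Submodule F A := Subalgebra.toSubmodule (Subalgebra.centralizer F {x, g})
  have hU (a : A) : a ∈ U ↔ x * a = a * x := by
    simp [U, Subalgebra.mem_centralizer_iff]
  have hW (a : A) : a ∈ W ↔ x * a = a * x ∧ g * a = a * g := by
    simp [W, Subalgebra.mem_centralizer_iff]
  have hpx := Algebra.commutes p x
  have hpg := Algebra.commutes p g
  have hdx := Algebra.commutes d x
  have hTU : Module.finrank F (⊤ : Submodule F A) ≤ 2 * Module.finrank F U := by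
    refine finrank_le_two_mul_of_map_le
      (LinearMap.mulLeft F x + LinearMap.mulRight F x - p • LinearMap.id) hg ?_ ?_
    · intro a _
      have hpa := Algebra.commutes p a
      have hqa := Algebra.commutes q a
      simp only [hU, LinearMap.sub_apply, LinearMap.add_apply, LinearMap.mulLeft_apply,
        LinearMap.mulRight_apply, LinearMap.smul_apply, LinearMap.id_apply]
      rw [Algebra.smul_def] at hx ⊢
      linear_combination (norm := noncomm_ring) hx * a - a * hx + hpx * a + hqa + hpa * x
    · intro a _ h
      simp only [LinearMap.sub_apply, LinearMap.add_apply, LinearMap.mulLeft_apply,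
        LinearMap.mulRight_apply, LinearMap.smul_apply, LinearMap.id_apply] at h
      rw [Algebra.smul_def] at h
      rw [hU]
      linear_combination (norm := noncomm_ring) hxg * a - g * h
  have hUW : Module.finrank F U ≤ 2 * Module.finrank F W := by
    refine finrank_le_two_mul_of_map_le (g := 2 * x - algebraMap F A p)
      (LinearMap.mulRight F g ∘ₗ LinearMap.mulLeft F g + LinearMap.mulLeft F (algebraMap F A d))
      (sub_ne_zero.mpr hsep) ?_ ?_
    · intro a ha
      have hpa := Algebra.commutes p a
      have hda := Algebra.commutes d a
      rw [hU] at ha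
      simp only [hW, LinearMap.add_apply, LinearMap.comp_apply, LinearMap.mulLeft_apply,
        LinearMap.mulRight_apply]
      constructor
      · linear_combination (norm := noncomm_ring) hxg * a * g - g * a * hxg - g * ha * g +
          g * hpa * g + g * a * hpg - hdx * a + algebraMap F A d * ha
      · linear_combination (norm := noncomm_ring) g * a * hd - hd * a * g + g * hda
    · intro a ha h
      rw [hU] at ha
      simp only [LinearMap.add_apply, LinearMap.comp_apply, LinearMap.mulLeft_apply,
        LinearMap.mulRight_apply] at h
      have hanti : a * g = -(g * a) := by
        refine mul_left_cancel₀ hg ?_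
        linear_combination (norm := noncomm_ring) h - hd * a
      rw [hW]
      constructor
      · linear_combination (norm := noncomm_ring) 2 * x * ha + hpx * a - algebraMap F A p * ha
      · linear_combination (norm := noncomm_ring)
          2 * hxg * a - hpg * a - (2 * x - algebraMap F A p) * hanti
  rw [finrank_top] at hTU
  change _ ≤ 4 * Module.finrank F W
  omega

/-- The element `w` is `x` itself if `x` and `t` commute. Otherwise it is the polar form of the
norm or the square of the commutator, unless both are scalars; in that case `x` and `t` generate a
quaternion algebra, whose centralizer is larger than `F` for dimension reasons. The element `x` is
assumed separable over `F`, in the form `2 x ≠ p`. -/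
theorem exists_notMem_bot_commute {F : Type u} [Field F] {A : Type v} [DivisionRing A]
    [Algebra F A] [FiniteDimensional F A] (hA : 4 < Module.finrank F A) {p q r s : F} {x t : A}
    (hx : x ^ 2 = p • x + algebraMap F A q) (ht : t ^ 2 = r • t + algebraMap F A s)
    (hxb : x ∉ (⊥ : Subalgebra F A)) (hsep : 2 * x ≠ algebraMap F A p) :
    ∃ w : A, w ∉ (⊥ : Subalgebra F A) ∧ Commute w x ∧ Commute w t := by
  by_cases hxt : Commute x t
  · exact ⟨x, hxb, Commute.refl x, hxt⟩
  by_cases hw : x * t + t * x - r • x - p • t ∈ (⊥ : Subalgebra F A)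
  swap
  · refine ⟨_, hw, commute_polar_of_sq_eq hx r t, ?_⟩
    convert commute_polar_of_sq_eq ht p x using 1
    abel
  obtain ⟨g, hgdef⟩ : ∃ g, g = x * t - t * x := ⟨_, rfl⟩
  have hg : g ≠ 0 := fun h ↦ hxt (sub_eq_zero.mp (hgdef ▸ h))
  have hxg : x * g = g * (algebraMap F A p - x) := hgdef ▸ mul_commutator_of_sq_eq hx t
  have htg : t * g = g * (algebraMap F A r - t) := by
    rw [hgdef, ← neg_sub (t * x), mul_neg, mul_commutator_of_sq_eq ht x, neg_mul]
  by_cases hg2 : g ^ 2 ∈ (⊥ : Subalgebra F A)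
  swap
  · exact ⟨g ^ 2, hg2, commute_sq_of_mul_eq_mul_sub hxg, commute_sq_of_mul_eq_mul_sub htg⟩
  obtain ⟨d, hd⟩ := Algebra.mem_bot.mp hg2
  obtain ⟨c, hc⟩ := Algebra.mem_bot.mp hw
  have hdim := finrank_le_four_mul_finrank_centralizer hx hsep hg hxg hd
  obtain ⟨w, hwW, hwb⟩ : ∃ w ∈ Subalgebra.centralizer F {x, g}, w ∉ (⊥ : Subalgebra F A) := by
    by_contra! h
    have hbot : Subalgebra.centralizer F {x, g} = ⊥ := le_bot_iff.mp fun w hw ↦ h w hw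
    rw [hbot, Subalgebra.finrank_bot] at hdim
    omega
  obtain ⟨hwx, hwg⟩ : x * w = w * x ∧ g * w = w * g := by
    simpa [Subalgebra.mem_centralizer_iff] using hwW
  refine ⟨w, hwb, hwx.symm, ?_⟩
  -- Since `(2 x - p) t = c + r x + g`, whatever commutes with `x` and `g` commutes with `t`.
  have hpw := Algebra.commutes p w
  have hcw := Algebra.commutes c w
  have hrw := Algebra.commutes r w
  rw [Algebra.smul_def, Algebra.smul_def] at hc
  have hut : (2 * x - algebraMap F A p) * t = algebraMap F A c + algebraMap F A r * x + g := by
    rw [hc, hgdef]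
    noncomm_ring
  refine (mul_left_cancel₀ (sub_ne_zero.mpr hsep) ?_ : w * t = t * w)
  linear_combination (norm := noncomm_ring) 2 * hwx * t - hpw * t + w * hut - hut * w - hcw -
    hrw * x - algebraMap F A r * hwx - hwg

/-- A quadratic element commuting with `x` and `t` is found in the field generated by an arbitrary
element outside `F` commuting with them. -/
theorem IsTwoField.exists_isQuadraticElem_commute {F : Type u} [Field F] (hF : IsTwoField F)
    {A : Type v} [DivisionRing A] [Algebra F A] [FiniteDimensional F A] {m : ℕ}
    (hA : Module.finrank F A = 2 ^ m) (hm : 2 < m) {p q r s : F} {x t : A}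
    (hx : x ^ 2 = p • x + algebraMap F A q) (ht : t ^ 2 = r • t + algebraMap F A s)
    (hxb : x ∉ (⊥ : Subalgebra F A)) (hsep : 2 * x ≠ algebraMap F A p) :
    ∃ z : A, IsQuadraticElem F z ∧ Commute z x ∧ Commute z t := by
  have hA4 : 4 < Module.finrank F A := hA ▸ (Nat.pow_lt_pow_right (by norm_num) hm : 2 ^ 2 < 2 ^ m)
  obtain ⟨w, hw, hwx, hwt⟩ := exists_notMem_bot_commute hA4 hx ht hxb hsep
  obtain ⟨z, hz, hzq⟩ := hF.exists_isQuadraticElem_mem_adjoin hA hw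
  have hcomm {y : A} (hy : Commute w y) : Commute z y :=
    (Algebra.commute_of_mem_adjoin_singleton_of_commute hz hy.symm).symm
  exact ⟨z, hzq, hcomm hwx, hcomm hwt⟩

/-! ### From quadratic to square-central and Artin-Schreier elements -/

section Normalization

variable {F : Type u} [Field F] {A : Type v} [DivisionRing A] [Algebra F A]
  [Algebra.IsCentral F A]

theorem notMem_center_iff {z : A} :
    z ∉ Subalgebra.center F A ↔ z ∉ (⊥ : Subalgebra F A) := by
  rw [Algebra.IsCentral.center_eq_bot]

theorem isSquareCentral_of_sq_eq {z : A} (hz : z ∉ (⊥ : Subalgebra F A)) {a : F}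
    (ha : z ^ 2 = algebraMap F A a) : IsSquareCentral F z := by
  refine ⟨notMem_center_iff.mpr hz, a, ?_, ha⟩
  rintro rfl
  rw [map_zero, sq_eq_zero_iff] at ha
  exact hz (ha ▸ zero_mem _)

/-- Completing the square: `z - p / 2` is square-central. -/
theorem IsQuadraticElem.exists_isSquareCentral (h2 : (2 : F) ≠ 0) {z : A}
    (hz : IsQuadraticElem F z) :
    ∃ y : A, IsSquareCentral F y ∧ ∀ a, Commute z a → Commute y a := by
  obtain ⟨hzb, p, q, hz⟩ := hz
  refine ⟨z - algebraMap F A (p / 2), isSquareCentral_of_sq_eq (a := q + (p / 2) ^ 2)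
    (fun h ↦ hzb ?_) ?_, fun a ha ↦ ha.sub_left (Algebra.commutes _ a)⟩
  · simpa using add_mem h (Subalgebra.algebraMap_mem ⊥ (p / 2))
  · have hc := Algebra.commutes (p / 2) z
    have hp : p = p / 2 + p / 2 := by field_simp; ring
    rw [hp, add_smul, Algebra.smul_def] at hz
    rw [map_add, map_pow]
    linear_combination (norm := noncomm_ring) hz + hc

/-- In characteristic 2 a quadratic element `z` of trace `p = 0` is square-central, and otherwise
`z / p` is Artin-Schreier. -/
theorem IsQuadraticElem.exists_isArtinSchreier_or_isSquareCentral [CharP F 2] {z : A}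
    (hz : IsQuadraticElem F z) :
    ∃ y : A, (IsArtinSchreier F y ∨ IsSquareCentral F y) ∧ ∀ a, Commute z a → Commute y a := by
  obtain ⟨hzb, p, q, hz⟩ := hz
  by_cases hp : p = 0
  · exact ⟨z, Or.inr (isSquareCentral_of_sq_eq hzb (a := q) (by simpa [hp] using hz)),
      fun _ h ↦ h⟩
  · refine ⟨p⁻¹ • z, Or.inl ⟨notMem_center_iff.mpr fun h ↦ hzb ?_, p⁻¹ ^ 2 * q, ?_⟩,
      fun a h ↦ h.smul_left _⟩
    · simpa [smul_smul, hp] using Subalgebra.smul_mem ⊥ h p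
    · have : CharP A 2 := charP_of_injective_algebraMap (algebraMap F A).injective 2
      have hpp : p⁻¹ ^ 2 * p = p⁻¹ := by field_simp
      rw [smul_pow, hz, smul_add, smul_smul, hpp, add_right_comm, CharTwo.add_self_eq_zero,
        zero_add, Algebra.smul_def, map_mul]

end Normalization

theorem mainTheorem7 (F : Type u) [Field F] (hF : IsTwoField F)
    (A : Type v) [DivisionRing A] [Algebra F A] [Algebra.IsCentral F A] [FiniteDimensional F A]
    (n : ℕ) (hn : 2 ≤ n) (hdeg : Module.finrank F A = (2 ^ n) ^ 2)
    (hexp : HasExponentTwo F A) :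
    (ringChar F = 2 → ∀ x t : A, IsArtinSchreier F x → IsArtinSchreier F t →
      ∃ z : A, (IsArtinSchreier F z ∨ IsSquareCentral F z) ∧ Commute z x ∧ Commute z t) ∧
    (ringChar F ≠ 2 → ∀ x t : A, IsSquareCentral F x → IsSquareCentral F t →
      ∃ z : A, IsSquareCentral F z ∧ Commute z x ∧ Commute z t) := by
  have hA : Module.finrank F A = 2 ^ (n * 2) := by rw [hdeg, pow_mul]
  constructor
  · rintro hchar x t ⟨hx, a, hxa⟩ ⟨-, b, htb⟩
    have : CharP F 2 := ringChar.of_eq hchar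
    have : CharP A 2 := charP_of_injective_algebraMap (algebraMap F A).injective 2
    have hquad {y : A} {e : F} (h : y ^ 2 + y = algebraMap F A e) :
        y ^ 2 = (-1 : F) • y + algebraMap F A e := by
      rw [← h, neg_one_smul]
      abel
    have hsep : 2 * x ≠ algebraMap F A (-1) := by
      rw [CharTwo.two_eq_zero, zero_mul, map_neg, map_one]
      exact (neg_ne_zero.mpr one_ne_zero).symm
    obtain ⟨z, hz, hzx, hzt⟩ := hF.exists_isQuadraticElem_commute hA (by omega) (hquad hxa)
      (hquad htb) (notMem_center_iff.mp hx) hsep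
    obtain ⟨y, hy, hyc⟩ := hz.exists_isArtinSchreier_or_isSquareCentral
    exact ⟨y, hy, hyc x hzx, hyc t hzt⟩
  · rintro hchar x t ⟨hx, a, ha, hxa⟩ ⟨-, b, -, htb⟩
    have h2 : (2 : F) ≠ 0 := Ring.two_ne_zero hchar
    have hquad {y : A} {e : F} (h : y ^ 2 = algebraMap F A e) :
        y ^ 2 = (0 : F) • y + algebraMap F A e := by
      rw [zero_smul, zero_add, h]
    have hsep : 2 * x ≠ algebraMap F A 0 := by
      have h2A : (2 : A) ≠ 0 := by
        rw [← map_ofNat (algebraMap F A) 2]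
        exact (map_ne_zero _).mpr h2
      have hx0 : x ≠ 0 := fun h ↦ hx (h ▸ zero_mem _)
      rw [map_zero]
      exact mul_ne_zero h2A hx0
    obtain ⟨z, hz, hzx, hzt⟩ := hF.exists_isQuadraticElem_commute hA (by omega) (hquad hxa)
      (hquad htb) (notMem_center_iff.mp hx) hsep
    obtain ⟨y, hy, hyc⟩ := hz.exists_isSquareCentral h2
    exact ⟨y, hy, hyc x hzx, hyc t hzt⟩
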